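/- Let $\psi_n(t)=\frac{\pi^{-1/4}}{\sqrt{2^n n!}}H_n(t)e^{-t^2/2}$, where $H_n(t)=(-1)^n e^{t^2}\frac{d^n}{dt^n}e^{-t^2}$, be the Hermite functions, let $\phi_n(\sigma,t)=\sqrt{\sigma}\,\psi_n(\sigma t)$, and for $N_c\in\mathbb N$, real coefficients $c_{2n},d_{2n}$ ($0\le n<N_c$) and $\sigma_\tau,\sigma_\nu>0$ let $$w_{\mathrm{tx}}(\tau,\nu)=w_1(\tau)w_2(\nu),\qquad w_1(\tau)=\sum_{n=0}^{N_c-1}c_{2n}\phi_{2n}(\sigma_\tau,\tau),\qquad w_2(\nu)=\sum_{n=0}^{N_c-1}d_{2n}\phi_{2n}(\sigma_\nu,\nu).$$ Let $w_{\mathrm{rx}}(\tau,\nu)=w_{\mathrm{tx}}^*(-\tau,-\nu)e^{j2\pi\nu\tau}$ be the matched receive filter and $h_{\mathrm{phy}}(\tau,\nu)=\sum_{i=1}^P h_i\delta(\tau-\tau_i)\delta(\nu-\nu_i)$ the physical channel, with $h_i\in\mathbb C$ and $\tau_i,\nu_i\in\mathbb R$. The effective channel is $h_{\mathrm{eff}}=w_{\mathrm{rx}}*_\sigma(h_{\mathrm{phy}}*_\sigma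 w_{\mathrm{tx}})$, where $(a*_\sigma b)(\tau,\nu)=\iint a(\tau',\nu')b(\tau-\tau',\nu-\nu')e^{j2\pi\nu'(\tau-\tau')}d\tau'd\nu'$ is the twisted convolution. Let $A_{f,g}(\tau,\nu)=\int f(t+\tau/2)g^*(t-\tau/2)e^{j2\pi\nu t}dt$ be the symmetric cross-ambiguity function. Then the integrals that define $h_{\mathrm{eff}}$ and $A_{\psi_n,\psi_m}$ converge absolutely, and for all $\tau,\nu\in\mathbb R$ $$h_{\mathrm{eff}}(\tau,\nu)=e^{j\pi\nu\tau}\sum_{i=1}^P h_ie^{-j\pi\nu_i\tau_i}\Big(\sum_{n_1,m_1=0}^{N_c-1}c_{2n_1}c_{2m_1}A_{\psi_{2n_1},\psi_{2m_1}}\big(\sigma_\tau(\tau_i-\tau),-\tfrac{\nu_i}{\sigma_\tau}\big)\Big)\Big(\sum_{n_2,m_2=0}^{N_c-1}d_{2n_2}d_{2m_2}A_{\psi_{2n_2},\psi_{2m_2}}\big(\sigma_\nu(\nu_i-\nu),\tfrac{\tau}{\sigma_\nu}\big)\Big).\tag{1}$$ Here, for all $n,m\in\mathbb N$ and $\tau,\nu\in\mathbb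 R$, $$A_{\psi_n,\psi_m}(\tau,\nu)=j^{\,n+m}e^{-j(n-m)\theta(\tau,\nu)}R_{n,m}(\tau,\nu),\tag{2}$$ $$R_{n,m}(\tau,\nu)=\pi^{1/4}\sqrt{\frac{n!\,m!}{2^{n+m}}}\sum_{k=0}^{\lfloor (m+n)/2\rfloor}v_{k,n,m}\,\psi_{n+m-2k}\Big(\sqrt{\tfrac{\tau^2+(2\pi\nu)^2}{2}}\Big),$$ $$v_{k,n,m}=\frac{1}{2^k\sqrt{(n+m-2k)!}}\sum_{u=0}^{\min(k,n,m)}\frac{(-4)^u(n+m-2u)!}{u!\,(m-u)!\,(n-u)!\,(k-u)!},$$ where $\theta(\tau,\nu)=\tan^{-1}\frac{\tau}{2\pi\nu}$ is taken in the quadrant of the point $(2\pi\nu,\tau)$, i.e. it is the argument in $(-\pi,\pi]$ of $2\pi\nu+j\tau$ ($0$ at the origin). Moreover, (1) remains true when every $A_{\psi_n,\psi_m}(\cdot,\cdot)$ in it is replaced by $(-j)^{n+m}e^{j(n-m)\theta}R_{n,m}$ at the same arguments. -/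

import Mathlib

noncomputable section

/-- The physicists' Hermite polynomial
`H_n(t) = (-1)^n e^{t^2} (d^n/dt^n) e^{-t^2}` (Rodrigues' formula). -/
def hermiteH (n : ℕ) (t : ℝ) : ℝ :=
  (-1) ^ n * Real.exp (t ^ 2) * iteratedDeriv n (fun s : ℝ => Real.exp (-s ^ 2)) t

/-- The orthonormal Hermite function
`ψ_n(t) = π^{-1/4} / √(2^n n!) * H_n(t) * e^{-t^2/2}`. -/
def hermitePsi (n : ℕ) (t : ℝ) : ℝ :=
  Real.pi ^ (-(1 / 4) : ℝ) / Real.sqrt (2 ^ n * (n.factorial : ℝ)) * hermiteH n t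
    * Real.exp (-t ^ 2 / 2)

/-- The scaled Hermite function `φ_n(σ, t) = √σ ψ_n(σ t)`. -/
def hermitePhi (n : ℕ) (σ t : ℝ) : ℝ :=
  Real.sqrt σ * hermitePsi n (σ * t)

/-- The one-dimensional Hermite pulse `w(t) = ∑_{n < N} a_{2n} φ_{2n}(σ, t)`; the entry `a n` of
the coefficient vector is the coefficient with index `2n`. -/
def hermitePulse {N : ℕ} (a : Fin N → ℝ) (σ t : ℝ) : ℝ :=
  ∑ n : Fin N, a n * hermitePhi (2 * (n : ℕ)) σ t

/-- The separable delay-Doppler filter `w(τ, ν) = w₁(τ) w₂(ν)`. -/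
def separableFilter (w₁ w₂ : ℝ → ℝ) (τ ν : ℝ) : ℂ :=
  (w₁ τ : ℂ) * (w₂ ν : ℂ)

/-- The receive filter matched to `w`: `w_rx(τ, ν) = conj (w(-τ, -ν)) e^{j2πντ}`. -/
def matchedFilter (w : ℝ → ℝ → ℂ) (τ ν : ℝ) : ℂ :=
  starRingEnd ℂ (w (-τ) (-ν)) * Complex.exp (2 * Real.pi * Complex.I * ν * τ)

/-- The physical channel `h_phy(τ, ν) = ∑_i h_i δ(τ - τ_i) δ(ν - ν_i)`, as a complex measure on
the delay-Doppler plane. -/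
def physicalChannel {P : ℕ} (h : Fin P → ℂ) (τp νp : Fin P → ℝ) :
    MeasureTheory.ComplexMeasure (ℝ × ℝ) :=
  ∑ i : Fin P, MeasureTheory.VectorMeasure.dirac (τp i, νp i) (h i)

/-- The integrand `a(τ', ν') b(τ - τ', ν - ν') e^{j2πν'(τ - τ')}`, as a function of
`p = (τ', ν')`, of the twisted convolution of two functions at `(τ, ν)`. -/
def twistedIntegrand (a b : ℝ → ℝ → ℂ) (τ ν : ℝ) (p : ℝ × ℝ) : ℂ :=
  a p.1 p.2 * b (τ - p.1) (ν - p.2)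
    * Complex.exp (2 * Real.pi * Complex.I * p.2 * (τ - p.1))

/-- Twisted convolution of two delay-Doppler functions. -/
def twistedConv (a b : ℝ → ℝ → ℂ) (τ ν : ℝ) : ℂ :=
  ∫ p : ℝ × ℝ, twistedIntegrand a b τ ν p

/-- Twisted convolution of a complex measure with a delay-Doppler function:
`∬ b(τ - τ', ν - ν') e^{j2πν'(τ - τ')} dμ(τ', ν')`. -/
def measureTwistedConv (μ : MeasureTheory.ComplexMeasure (ℝ × ℝ)) (b : ℝ → ℝ → ℂ)
    (τ ν : ℝ) : ℂ :=
  μ.integral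
    (fun p : ℝ × ℝ => b (τ - p.1) (ν - p.2)
      * Complex.exp (2 * Real.pi * Complex.I * p.2 * (τ - p.1)))
    (ContinuousLinearMap.mul ℝ ℂ)

/-- The effective channel: the twisted convolution cascade `w_rx * (h_phy * w_tx)` with the
receive filter matched to the transmit filter. -/
def effectiveChannel (μ : MeasureTheory.ComplexMeasure (ℝ × ℝ)) (wtx : ℝ → ℝ → ℂ)
    (τ ν : ℝ) : ℂ :=
  twistedConv (matchedFilter wtx) (measureTwistedConv μ wtx) τ ν

/-- The integrand `f(t + τ/2) conj (g(t - τ/2)) e^{j2πνt}` of the symmetric cross-ambiguity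
function. -/
def ambiguityIntegrand (f g : ℝ → ℂ) (τ ν t : ℝ) : ℂ :=
  f (t + τ / 2) * starRingEnd ℂ (g (t - τ / 2))
    * Complex.exp (2 * Real.pi * Complex.I * ν * t)

/-- The symmetric cross-ambiguity function `A_{f,g}(τ, ν)`. -/
def crossAmbiguity (f g : ℝ → ℂ) (τ ν : ℝ) : ℂ :=
  ∫ t : ℝ, ambiguityIntegrand f g τ ν t

/-- The symmetric cross-ambiguity function `A_{ψ_n,ψ_m}` of two Hermite functions. -/
def hermiteAmbiguity (n m : ℕ) (τ ν : ℝ) : ℂ :=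
  crossAmbiguity (fun t => (hermitePsi n t : ℂ)) (fun t => (hermitePsi m t : ℂ)) τ ν

/-- The coefficient `v_{k,n,m}` (used for `2k ≤ n + m`, where no subtraction truncates). -/
def hermiteV (k n m : ℕ) : ℝ :=
  1 / (2 ^ k * Real.sqrt ((n + m - 2 * k).factorial : ℝ))
    * ∑ u ∈ Finset.range (min k (min n m) + 1),
        (-4 : ℝ) ^ u * ((n + m - 2 * u).factorial : ℝ)
          / ((u.factorial : ℝ) * ((m - u).factorial : ℝ) * ((n - u).factorial : ℝ)
              * ((k - u).factorial : ℝ))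

/-- The real radial factor of the closed form of `A_{ψ_n,ψ_m}(τ, ν)`. -/
def hermiteRadial (n m : ℕ) (τ ν : ℝ) : ℝ :=
  Real.pi ^ ((1 / 4 : ℝ))
    * Real.sqrt ((n.factorial : ℝ) * (m.factorial : ℝ) / 2 ^ (n + m))
    * ∑ k ∈ Finset.range ((m + n) / 2 + 1),
        hermiteV k n m
          * hermitePsi (n + m - 2 * k) (Real.sqrt ((τ ^ 2 + (2 * Real.pi * ν) ^ 2) / 2))

/-- The angle `tan⁻¹(τ / (2πν))`, with the quadrant of the point `(2πν, τ)` taken into account,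
so that it is also meaningful for `ν ≤ 0`. -/
def ambiguityAngle (τ ν : ℝ) : ℝ :=
  Complex.arg (((2 * Real.pi * ν : ℝ) : ℂ) + Complex.I * (τ : ℂ))

/-- The expression `(-j)^{n+m} e^{j(n-m)θ} R_{n,m}(τ, ν)` with the angle `θ` and the radial
factor `R_{n,m}` above. -/
def hermiteClosedForm (n m : ℕ) (τ ν : ℝ) : ℂ :=
  (-Complex.I) ^ (n + m)
    * Complex.exp (Complex.I * ((n : ℂ) - (m : ℂ)) * (ambiguityAngle τ ν : ℂ))
    * (hermiteRadial n m τ ν : ℂ)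

end

/-! Closed form of the ambiguity function. Write h_n = H_n e^{-t²/2}. Its derivative is t h_n -
h_{n+1} and also 2n h_{n-1} - t h_n. Differentiating h_n(t+τ/2) h_m(t-τ/2) e^{2πiνt}, with one
formula for each factor, cancels the multiplications by t. The integral of the derivative is zero,
which gives a recursion in (n, m) (`gaussAmbiguity_succ_left`, `gaussAmbiguity_zero_succ`). With a =
i(2πν - iτ) and b = i(2πν + iτ), its solution is the Gaussian base case times a Laguerre-type
polynomial in a and b (`gaussAmbiguity_eq`). In polar form every term of that polynomial carries the
same phase, so a real radial sum remains (`laguerreSum_polar`). The sum over Hermite functions in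
R_{n,m} is this radial sum with each monomial expanded in Hermite polynomials (`hermiteRadial_eq`).

Effective channel. The phase of the matched filter cancels the mixed term ν'τ' of the twisted
convolution, so the double integral for each path is a product of two one-dimensional integrals
(`twistedIntegrand_matchedFilter`). A reflection and a shift turn these into ambiguity functions of
the pulses; scaling and bilinearity reduce them to Hermite functions. Even pulses make the sign of
the Doppler argument immaterial.

Opposite phases. For even indices, reversing the phase amounts to exchanging n and m, and the double
sums are symmetric in their coefficients. -/

/-! ### Hermite polynomials: Rodrigues' formula, recurrences, parity. -/

open Polynomial in
/-- The physicists' Hermite polynomial as a polynomial, `H_{n+1} = 2 X H_n - H_n'`. -/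
noncomputable def hermitePoly : ℕ → ℝ[X]
  | 0 => 1
  | n + 1 => C 2 * X * hermitePoly n - derivative (hermitePoly n)

theorem hermitePoly_succ (n : ℕ) :
    hermitePoly (n + 1) = Polynomial.C 2 * Polynomial.X * hermitePoly n
      - Polynomial.derivative (hermitePoly n) := rfl

theorem iteratedDeriv_exp_neg_sq (n : ℕ) :
    iteratedDeriv n (fun s : ℝ => Real.exp (-s ^ 2))
      = fun t => (-1) ^ n * (hermitePoly n).eval t * Real.exp (-t ^ 2) := by
  induction n with
  | zero => ext t; simp [hermitePoly]
  | succ n ih =>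
    ext t
    rw [iteratedDeriv_succ, ih]
    have h1 : HasDerivAt (fun t : ℝ => Real.exp (-t ^ 2))
        (Real.exp (-t ^ 2) * (-(2 * t))) t := by
      have := ((hasDerivAt_pow 2 t).neg).exp
      simpa using this
    have h2 := (((hermitePoly n).hasDerivAt t).const_mul ((-1 : ℝ) ^ n)).mul h1
    refine h2.deriv.trans ?_
    simp only [hermitePoly_succ, Polynomial.eval_sub, Polynomial.eval_mul, Polynomial.eval_C,
      Polynomial.eval_X]
    ring

theorem hermiteH_eq_eval (n : ℕ) (t : ℝ) : hermiteH n t = (hermitePoly n).eval t := by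
  rw [hermiteH, iteratedDeriv_exp_neg_sq]
  have h : Real.exp (t ^ 2) * Real.exp (-t ^ 2) = 1 := by rw [← Real.exp_add]; simp
  have h' : ((-1 : ℝ) ^ n) * (-1) ^ n = 1 := by rw [← mul_pow]; simp
  calc _ = ((-1 : ℝ) ^ n * (-1) ^ n) * (Real.exp (t ^ 2) * Real.exp (-t ^ 2))
        * (hermitePoly n).eval t := by ring
    _ = _ := by rw [h, h']; ring

/-- Since natural subtraction truncates, at `n = 0` this reads `H_0' = 0`. -/
theorem derivative_hermitePoly (n : ℕ) :
    Polynomial.derivative (hermitePoly n)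
      = Polynomial.C (2 * (n : ℝ)) * hermitePoly (n - 1) := by
  induction n with
  | zero => simp [hermitePoly]
  | succ n ih =>
    rw [hermitePoly_succ, Polynomial.derivative_sub, Polynomial.derivative_mul,
      Polynomial.derivative_mul, ih]
    cases n with
    | zero => simp [hermitePoly]
    | succ n =>
      simp only [Nat.add_sub_cancel, Polynomial.derivative_mul, Polynomial.derivative_C,
        Polynomial.derivative_X, hermitePoly_succ n]
      push_cast
      simp only [map_mul, map_add, map_one]
      ring

theorem two_mul_mul_hermitePoly_eval (n : ℕ) (t : ℝ) :
    2 * t * (hermitePoly n).eval t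
      = (hermitePoly (n + 1)).eval t + 2 * n * (hermitePoly (n - 1)).eval t := by
  rw [hermitePoly_succ, derivative_hermitePoly]
  simp

theorem hermitePoly_eval_neg (n : ℕ) (t : ℝ) :
    (hermitePoly n).eval (-t) = (-1) ^ n * (hermitePoly n).eval t := by
  have key : ∀ n, (hermitePoly n).comp (-Polynomial.X)
      = Polynomial.C ((-1) ^ n) * hermitePoly n := by
    intro n
    induction n with
    | zero => simp [hermitePoly]
    | succ n ih =>
      -- The recursion also involves H_n', whose parity comes from differentiating the induction
      -- hypothesis.
      have h := congrArg Polynomial.derivative ih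
      rw [Polynomial.derivative_comp] at h
      simp only [Polynomial.derivative_neg, Polynomial.derivative_X, Polynomial.derivative_mul,
        Polynomial.derivative_C, zero_mul, zero_add] at h
      simp only [hermitePoly_succ, Polynomial.sub_comp, Polynomial.mul_comp, Polynomial.C_comp,
        Polynomial.X_comp, ih]
      have h' : (Polynomial.derivative (hermitePoly n)).comp (-Polynomial.X)
          = -(Polynomial.C ((-1) ^ n) * Polynomial.derivative (hermitePoly n)) := by
        rw [← h]; ring
      rw [h', pow_succ]
      simp only [map_mul, map_neg, map_one]
      ring
  have h := congrArg (Polynomial.eval t) (key n)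
  simpa using h

/-! ### Monomials in terms of Hermite polynomials. -/

/-- The coefficient of `H_{M-2j}` in the expansion of `(2t)^M`. -/
noncomputable def monomialHermiteCoeff (M j : ℕ) : ℝ :=
  if 2 * j ≤ M then (M.factorial : ℝ) / ((j.factorial : ℝ) * ((M - 2 * j).factorial : ℝ)) else 0

theorem monomialHermiteCoeff_zero_right (M : ℕ) : monomialHermiteCoeff M 0 = 1 := by
  have : (M.factorial : ℝ) ≠ 0 := by positivity
  simp [monomialHermiteCoeff, this]

/-- This is 2t H_k = H_{k+1} + 2k H_{k-1} read on coefficients, with k = M - 2j. -/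
theorem monomialHermiteCoeff_succ_succ (M j : ℕ) :
    monomialHermiteCoeff (M + 1) (j + 1)
      = monomialHermiteCoeff M (j + 1)
        + 2 * ((M - 2 * j : ℕ) : ℝ) * monomialHermiteCoeff M j := by
  unfold monomialHermiteCoeff
  rcases lt_or_ge M (2 * j + 1) with h | h
  -- For M ≤ 2j everything vanishes: at M = 2j through the factor M - 2j, below that through the
  -- default value 0.
  · rw [if_neg (by omega), if_neg (by omega)]
    rcases lt_or_ge M (2 * j) with h' | h'
    · rw [if_neg (by omega)]; simp
    · have : M - 2 * j = 0 := by omega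
      simp [this]
  · obtain ⟨r, rfl⟩ := Nat.exists_eq_add_of_le h
    have hj : (j.factorial : ℝ) ≠ 0 := by positivity
    have hj' : (j : ℝ) + 1 ≠ 0 := by positivity
    have hr : (r.factorial : ℝ) ≠ 0 := by positivity
    have hr' : (r : ℝ) + 1 ≠ 0 := by positivity
    rw [if_pos (show 2 * (j + 1) ≤ 2 * j + 1 + r + 1 by omega),
      if_pos (show 2 * j ≤ 2 * j + 1 + r by omega),
      show 2 * j + 1 + r + 1 - 2 * (j + 1) = r by omega,
      show 2 * j + 1 + r - 2 * j = r + 1 by omega, Nat.factorial_succ (2 * j + 1 + r),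
      Nat.factorial_succ r, Nat.factorial_succ j]
    cases r with
    | zero =>
      rw [if_neg (by omega)]
      push_cast
      field_simp
      ring
    | succ r =>
      rw [if_pos (by omega), show 2 * j + 1 + (r + 1) - 2 * (j + 1) = r by omega,
        Nat.factorial_succ r]
      rw [Nat.factorial_succ r] at hr
      push_cast at hr hr' ⊢
      have hr1 : (r : ℝ) + 1 ≠ 0 := left_ne_zero_of_mul hr
      have hr2 : (r.factorial : ℝ) ≠ 0 := right_ne_zero_of_mul hr
      field_simp
      ring

/-- Induction on M, multiplying by 2t. Coefficients beyond 2j ≤ M are 0, so the upper limit K is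
free; this lets the formula fit the range left after the double sum in R_{n,m} is reordered. -/
theorem two_mul_pow_eq_sum_hermitePoly (M K : ℕ) (hK : M < 2 * K) (t : ℝ) :
    (2 * t) ^ M = ∑ j ∈ Finset.range K,
      monomialHermiteCoeff M j * (hermitePoly (M - 2 * j)).eval t := by
  have extend : ∀ M K, M < 2 * K → ∀ K', K ≤ K' →
      ∑ j ∈ Finset.range K', monomialHermiteCoeff M j * (hermitePoly (M - 2 * j)).eval t
      = ∑ j ∈ Finset.range K, monomialHermiteCoeff M j * (hermitePoly (M - 2 * j)).eval t := by
    intro M K hK K' hKK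
    symm
    apply Finset.sum_subset (Finset.range_mono hKK)
    intro j _ hj
    rw [Finset.mem_range, not_lt] at hj
    rw [monomialHermiteCoeff, if_neg (by omega), zero_mul]
  have main : ∀ M, (2 * t) ^ M = ∑ j ∈ Finset.range (M + 1),
      monomialHermiteCoeff M j * (hermitePoly (M - 2 * j)).eval t := by
    intro M
    induction M with
    | zero => simp [monomialHermiteCoeff, hermitePoly]
    | succ M ih =>
      have hterm : ∀ j, 2 * t * (monomialHermiteCoeff M j * (hermitePoly (M - 2 * j)).eval t)
          = monomialHermiteCoeff M j * (hermitePoly (M + 1 - 2 * j)).eval t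
            + 2 * ((M - 2 * j : ℕ) : ℝ) * monomialHermiteCoeff M j
              * (hermitePoly (M + 1 - 2 * (j + 1))).eval t := by
        intro j
        by_cases hj : 2 * j ≤ M
        · rw [show M + 1 - 2 * j = M - 2 * j + 1 by omega,
            show M + 1 - 2 * (j + 1) = M - 2 * j - 1 by omega]
          linear_combination monomialHermiteCoeff M j
            * two_mul_mul_hermitePoly_eval (M - 2 * j) t
        · simp [monomialHermiteCoeff, hj]
      have hsucc : ∀ j, monomialHermiteCoeff (M + 1) (j + 1)
            * (hermitePoly (M + 1 - 2 * (j + 1))).eval t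
          = monomialHermiteCoeff M (j + 1) * (hermitePoly (M + 1 - 2 * (j + 1))).eval t
            + 2 * ((M - 2 * j : ℕ) : ℝ) * monomialHermiteCoeff M j
              * (hermitePoly (M + 1 - 2 * (j + 1))).eval t := fun j => by
        rw [monomialHermiteCoeff_succ_succ, add_mul]
      have h0 : monomialHermiteCoeff M (M + 1) = 0 := by
        rw [monomialHermiteCoeff, if_neg (by omega)]
      rw [pow_succ', ih, Finset.mul_sum, Finset.sum_congr rfl fun j _ => hterm j,
        Finset.sum_add_distrib, Finset.sum_range_succ' _ (M + 1),
        Finset.sum_congr rfl fun j _ => hsucc j, Finset.sum_add_distrib,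
        Finset.sum_range_succ' (fun j => monomialHermiteCoeff M j
          * (hermitePoly (M + 1 - 2 * j)).eval t) M,
        Finset.sum_range_succ (fun j => monomialHermiteCoeff M (j + 1)
          * (hermitePoly (M + 1 - 2 * (j + 1))).eval t) M, h0,
        monomialHermiteCoeff_zero_right, monomialHermiteCoeff_zero_right]
      ring
  rw [main M]
  rcases le_total K (M + 1) with h | h
  · exact extend M K hK _ h
  · exact (extend M (M + 1) (by omega) _ h).symm

/-! ### Hermite functions and absolute convergence. -/

theorem integrable_eval_mul_exp_neg_sq (p : Polynomial ℝ) :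
    MeasureTheory.Integrable (fun t : ℝ => p.eval t * Real.exp (-t ^ 2)) := by
  induction p using Polynomial.induction_on' with
  | add p q hp hq =>
    refine (hp.add hq).congr (Filter.Eventually.of_forall fun t => ?_)
    simp only [Pi.add_apply, Polynomial.eval_add]
    ring
  | monomial n a =>
    have h := (integrable_rpow_mul_exp_neg_mul_sq (b := 1) one_pos (s := n)
      (by have : (0 : ℝ) ≤ n := n.cast_nonneg
          linarith)).const_mul a
    refine h.congr (Filter.Eventually.of_forall fun t => ?_)
    simp only [Polynomial.eval_monomial, Real.rpow_natCast]
    ring_nf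

/-- The unnormalized Hermite function `H_n(t) e^{-t^2/2}`. -/
noncomputable def hermiteGauss (n : ℕ) (t : ℝ) : ℝ :=
  (hermitePoly n).eval t * Real.exp (-t ^ 2 / 2)

theorem hermitePsi_eq (n : ℕ) (t : ℝ) :
    hermitePsi n t = Real.pi ^ (-(1 / 4) : ℝ) / Real.sqrt (2 ^ n * (n.factorial : ℝ))
      * hermiteGauss n t := by
  rw [hermitePsi, hermiteH_eq_eval, hermiteGauss]
  ring

theorem hasDerivAt_hermiteGauss (n : ℕ) (t : ℝ) :
    HasDerivAt (hermiteGauss n)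
      ((hermitePoly n).derivative.eval t * Real.exp (-t ^ 2 / 2) - t * hermiteGauss n t) t := by
  have h1 : HasDerivAt (fun t : ℝ => Real.exp (-t ^ 2 / 2)) (Real.exp (-t ^ 2 / 2) * (-t)) t := by
    have h : HasDerivAt (fun t : ℝ => -t ^ 2 / 2) (-t) t :=
      (((hasDerivAt_pow 2 t).neg).div_const 2).congr_deriv (by push_cast; ring)
    exact h.exp
  refine (((hermitePoly n).hasDerivAt t).mul h1).congr_deriv ?_
  rw [hermiteGauss]
  ring

theorem continuous_hermiteGauss (n : ℕ) : Continuous (hermiteGauss n) :=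
  continuous_iff_continuousAt.2 fun t => (hasDerivAt_hermiteGauss n t).continuousAt

theorem hasDerivAt_hermiteGauss_raise (n : ℕ) (t : ℝ) :
    HasDerivAt (hermiteGauss n) (t * hermiteGauss n t - hermiteGauss (n + 1) t) t := by
  convert hasDerivAt_hermiteGauss n t using 1
  simp only [hermiteGauss, hermitePoly_succ, Polynomial.eval_sub, Polynomial.eval_mul,
    Polynomial.eval_C, Polynomial.eval_X]
  ring

theorem hasDerivAt_hermiteGauss_lower (n : ℕ) (t : ℝ) :
    HasDerivAt (hermiteGauss n) (2 * n * hermiteGauss (n - 1) t - t * hermiteGauss n t) t := by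
  convert hasDerivAt_hermiteGauss n t using 1
  simp only [hermiteGauss, derivative_hermitePoly, Polynomial.eval_mul, Polynomial.eval_C]
  ring

/-- The ambiguity integrand of two unnormalized Hermite functions. -/
noncomputable def gaussIntegrand (n m : ℕ) (τ ν t : ℝ) : ℂ :=
  ambiguityIntegrand (fun t => (hermiteGauss n t : ℂ)) (fun t => (hermiteGauss m t : ℂ)) τ ν t

theorem gaussIntegrand_eq (n m : ℕ) (τ ν t : ℝ) :
    gaussIntegrand n m τ ν t = (hermiteGauss n (t + τ / 2) : ℂ) * (hermiteGauss m (t - τ / 2) : ℂ)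
      * Complex.exp (2 * Real.pi * Complex.I * ν * t) := by
  simp [gaussIntegrand, ambiguityIntegrand, Complex.conj_ofReal]

/-- The oscillating factor has modulus 1, and the two shifted Gaussians multiply to e^{-τ²/4}
e^{-t²}. -/
theorem integrable_gaussIntegrand (n m : ℕ) (τ ν : ℝ) :
    MeasureTheory.Integrable (gaussIntegrand n m τ ν) := by
  have h := (integrable_eval_mul_exp_neg_sq
    ((hermitePoly n).comp (Polynomial.X + Polynomial.C (τ / 2))
      * (hermitePoly m).comp (Polynomial.X - Polynomial.C (τ / 2)))).const_mul
        (Real.exp (-τ ^ 2 / 4))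
  refine h.mono ?_ (Filter.Eventually.of_forall fun t => le_of_eq ?_)
  · have hn := continuous_hermiteGauss n
    have hm := continuous_hermiteGauss m
    have : Continuous (gaussIntegrand n m τ ν) := by
      rw [funext fun t => gaussIntegrand_eq n m τ ν t]
      fun_prop
    exact this.aestronglyMeasurable
  · have he : 2 * Real.pi * Complex.I * ν * t = ((2 * Real.pi * ν * t : ℝ) : ℂ) * Complex.I := by
      push_cast; ring
    rw [gaussIntegrand_eq, norm_mul, he, Complex.norm_exp_ofReal_mul_I, mul_one,
      ← Complex.ofReal_mul, Complex.norm_real]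
    congr 1
    simp only [hermiteGauss, Polynomial.eval_mul, Polynomial.eval_comp, Polynomial.eval_add,
      Polynomial.eval_sub, Polynomial.eval_X, Polynomial.eval_C]
    have : Real.exp (-(t + τ / 2) ^ 2 / 2) * Real.exp (-(t - τ / 2) ^ 2 / 2)
        = Real.exp (-τ ^ 2 / 4) * Real.exp (-t ^ 2) := by
      rw [← Real.exp_add, ← Real.exp_add]
      congr 1
      ring
    linear_combination (Polynomial.eval (t + τ / 2) (hermitePoly n)
      * Polynomial.eval (t - τ / 2) (hermitePoly m)) * this

theorem hasDerivAt_gaussIntegrand (n m : ℕ) (τ ν t dn dm : ℝ)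
    (hn : HasDerivAt (hermiteGauss n) dn (t + τ / 2))
    (hm : HasDerivAt (hermiteGauss m) dm (t - τ / 2)) :
    HasDerivAt (gaussIntegrand n m τ ν)
      (((dn : ℂ) * (hermiteGauss m (t - τ / 2) : ℂ) + (hermiteGauss n (t + τ / 2) : ℂ) * (dm : ℂ)
        + 2 * Real.pi * Complex.I * ν * ((hermiteGauss n (t + τ / 2) : ℂ)
          * (hermiteGauss m (t - τ / 2) : ℂ)))
        * Complex.exp (2 * Real.pi * Complex.I * ν * t)) t := by
  rw [funext fun t => gaussIntegrand_eq n m τ ν t]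
  have h1 := (hn.comp_add_const t (τ / 2)).ofReal_comp
  have h2 := (hm.comp_sub_const t (τ / 2)).ofReal_comp
  have h3 : HasDerivAt (fun t : ℝ => Complex.exp (2 * Real.pi * Complex.I * ν * (t : ℂ)))
      (Complex.exp (2 * Real.pi * Complex.I * ν * t) * (2 * Real.pi * Complex.I * ν)) t := by
    have := ((Complex.ofRealCLM.hasDerivAt (x := t)).const_mul (2 * Real.pi * Complex.I * ν)).cexp
    simpa using this
  refine ((h1.mul h2).mul h3).congr_deriv ?_
  simp only [Pi.mul_apply]
  ring

/-! ### Recursion for the ambiguity integrals. -/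

/-- The integral of `gaussIntegrand`. -/
noncomputable def gaussAmbiguity (n m : ℕ) (τ ν : ℝ) : ℂ := ∫ t : ℝ, gaussIntegrand n m τ ν t

/-- Raising the first factor contributes t + τ/2 and lowering the second -(t - τ/2). Their sum τ
joins 2πiν from the exponential to form i(2πν - iτ). -/
theorem gaussAmbiguity_succ_left (n m : ℕ) (τ ν : ℝ) :
    gaussAmbiguity (n + 1) m τ ν
      = Complex.I * (2 * Real.pi * ν - Complex.I * τ) * gaussAmbiguity n m τ ν
        + 2 * m * gaussAmbiguity n (m - 1) τ ν := by
  have i1 := integrable_gaussIntegrand (n + 1) m τ ν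
  have i2 := (integrable_gaussIntegrand n m τ ν).const_mul
    (Complex.I * (2 * Real.pi * ν - Complex.I * τ))
  have i3 := (integrable_gaussIntegrand n (m - 1) τ ν).const_mul (2 * (m : ℂ))
  have key : ∀ t, HasDerivAt (gaussIntegrand n m τ ν)
      (Complex.I * (2 * Real.pi * ν - Complex.I * τ) * gaussIntegrand n m τ ν t
        + 2 * m * gaussIntegrand n (m - 1) τ ν t - gaussIntegrand (n + 1) m τ ν t) t := by
    intro t
    convert hasDerivAt_gaussIntegrand n m τ ν t _ _ (hasDerivAt_hermiteGauss_raise n _)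
      (hasDerivAt_hermiteGauss_lower m _) using 1
    simp only [gaussIntegrand_eq]
    push_cast
    linear_combination (-(τ : ℂ) * (hermiteGauss n (t + τ / 2) : ℂ)
      * (hermiteGauss m (t - τ / 2) : ℂ)
      * Complex.exp (2 * Real.pi * Complex.I * ν * t)) * Complex.I_sq
  have h := MeasureTheory.integral_eq_zero_of_hasDerivAt_of_integrable key
    ((i2.add i3).sub i1) (integrable_gaussIntegrand n m τ ν)
  rw [MeasureTheory.integral_sub (by exact i2.add i3) i1, MeasureTheory.integral_add i2 i3,
    MeasureTheory.integral_const_mul, MeasureTheory.integral_const_mul] at h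
  exact (sub_eq_zero.1 h).symm

/-- The roles are exchanged: the first factor is lowered, which leaves no lower term at index 0, and
the second is raised. -/
theorem gaussAmbiguity_zero_succ (m : ℕ) (τ ν : ℝ) :
    gaussAmbiguity 0 (m + 1) τ ν
      = Complex.I * (2 * Real.pi * ν + Complex.I * τ) * gaussAmbiguity 0 m τ ν := by
  have i1 := integrable_gaussIntegrand 0 (m + 1) τ ν
  have i2 := (integrable_gaussIntegrand 0 m τ ν).const_mul
    (Complex.I * (2 * Real.pi * ν + Complex.I * τ))
  have key : ∀ t, HasDerivAt (gaussIntegrand 0 m τ ν)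
      (Complex.I * (2 * Real.pi * ν + Complex.I * τ) * gaussIntegrand 0 m τ ν t
        - gaussIntegrand 0 (m + 1) τ ν t) t := by
    intro t
    convert hasDerivAt_gaussIntegrand 0 m τ ν t _ _ (hasDerivAt_hermiteGauss_lower 0 _)
      (hasDerivAt_hermiteGauss_raise m _) using 1
    simp only [gaussIntegrand_eq]
    push_cast
    linear_combination ((τ : ℂ) * (hermiteGauss 0 (t + τ / 2) : ℂ)
      * (hermiteGauss m (t - τ / 2) : ℂ)
      * Complex.exp (2 * Real.pi * Complex.I * ν * t)) * Complex.I_sq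
  have h := MeasureTheory.integral_eq_zero_of_hasDerivAt_of_integrable key
    (i2.sub i1) (integrable_gaussIntegrand 0 m τ ν)
  rw [MeasureTheory.integral_sub i2 i1, MeasureTheory.integral_const_mul] at h
  exact (sub_eq_zero.1 h).symm

theorem gaussAmbiguity_zero_zero (τ ν : ℝ) :
    gaussAmbiguity 0 0 τ ν
      = (Real.sqrt Real.pi * Real.exp (-(τ ^ 2 + (2 * Real.pi * ν) ^ 2) / 4) : ℝ) := by
  have h := fourierIntegral_gaussian (b := 1) (by simp) (2 * Real.pi * ν)
  have hi : ∀ t : ℝ, gaussIntegrand 0 0 τ ν t = Complex.exp (-τ ^ 2 / 4)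
      * (Complex.exp (Complex.I * (2 * Real.pi * ν) * t) * Complex.exp (-1 * t ^ 2)) := by
    intro t
    rw [gaussIntegrand_eq]
    simp only [hermiteGauss, hermitePoly, Polynomial.eval_one, one_mul, Complex.ofReal_exp]
    rw [← Complex.exp_add, ← Complex.exp_add, ← Complex.exp_add, ← Complex.exp_add]
    congr 1
    push_cast
    ring
  rw [gaussAmbiguity, MeasureTheory.integral_congr_ae (Filter.Eventually.of_forall hi),
    MeasureTheory.integral_const_mul, h, div_one]
  have hp : ((Real.pi : ℂ) ^ (1 / 2 : ℂ)) = (Real.sqrt Real.pi : ℝ) := by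
    rw [Real.sqrt_eq_rpow, Complex.ofReal_cpow Real.pi_pos.le]
    norm_num
  rw [hp, mul_left_comm, ← Complex.exp_add, Complex.ofReal_mul, Complex.ofReal_exp]
  congr 2
  push_cast
  ring

/-! ### Solution of the recursion. -/

/-- The polynomial `∑_u 2^u u! C(n,u) C(m,u) a^{n-u} b^{m-u}`. -/
noncomputable def laguerreSum (n m : ℕ) (a b : ℂ) : ℂ :=
  ∑ u ∈ Finset.range (n + 1),
    ((n.choose u * m.choose u * u.factorial * 2 ^ u : ℕ) : ℂ) * a ^ (n - u) * b ^ (m - u)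

/-- Pascal's rule splits C(n+1, u+1); the absorption identity (u+1) C(m, u+1) = m C(m-1, u) turns
one half into the sum for m - 1. -/
theorem laguerreSum_succ_left (n m : ℕ) (a b : ℂ) :
    laguerreSum (n + 1) m a b = a * laguerreSum n m a b + 2 * m * laguerreSum n (m - 1) a b := by
  have hnat : ∀ u, m.choose (u + 1) * (u + 1) = m * (m - 1).choose u := by
    intro u
    cases m with
    | zero => simp
    | succ m => rw [Nat.add_sub_cancel, ← Nat.add_one_mul_choose_eq]
  have hsplit : ∀ u, (((n + 1).choose (u + 1) * m.choose (u + 1) * (u + 1).factorial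
        * 2 ^ (u + 1) : ℕ) : ℂ) * a ^ (n + 1 - (u + 1)) * b ^ (m - (u + 1))
      = ((n.choose (u + 1) * m.choose (u + 1) * (u + 1).factorial * 2 ^ (u + 1) : ℕ) : ℂ)
          * a ^ (n + 1 - (u + 1)) * b ^ (m - (u + 1))
        + 2 * m * (((n.choose u * (m - 1).choose u * u.factorial * 2 ^ u : ℕ) : ℂ)
          * a ^ (n - u) * b ^ (m - 1 - u)) := by
    intro u
    have h : ((m.choose (u + 1) : ℂ)) * (u + 1) = m * ((m - 1).choose u : ℂ) := by
      exact_mod_cast hnat u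
    rw [Nat.choose_succ_succ, Nat.factorial_succ, show n + 1 - (u + 1) = n - u by omega,
      show m - (u + 1) = m - 1 - u by omega]
    push_cast
    linear_combination (2 * (n.choose u : ℂ) * u.factorial * 2 ^ u * a ^ (n - u)
      * b ^ (m - 1 - u)) * h
  have hshift : ∀ u ∈ Finset.range (n + 1),
      ((n.choose u * m.choose u * u.factorial * 2 ^ u : ℕ) : ℂ) * a ^ (n + 1 - u) * b ^ (m - u)
      = a * (((n.choose u * m.choose u * u.factorial * 2 ^ u : ℕ) : ℂ)
          * a ^ (n - u) * b ^ (m - u)) := by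
    intro u hu
    rw [Finset.mem_range] at hu
    rw [show n + 1 - u = (n - u) + 1 by omega, pow_succ]
    ring
  -- Shifting the other half back to index u produces a term u = n + 1, which is zero.
  have hlast : ((n.choose (n + 1) * m.choose (n + 1) * (n + 1).factorial * 2 ^ (n + 1) : ℕ) : ℂ)
      * a ^ (n + 1 - (n + 1)) * b ^ (m - (n + 1)) = 0 := by simp
  rw [laguerreSum, Finset.sum_range_succ', Finset.sum_congr rfl fun u _ => hsplit u,
    Finset.sum_add_distrib, laguerreSum, laguerreSum, Finset.mul_sum, Finset.mul_sum,
    ← Finset.sum_congr rfl hshift, add_right_comm]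
  congr 1
  have := Finset.sum_range_succ' (fun u =>
    ((n.choose u * m.choose u * u.factorial * 2 ^ u : ℕ) : ℂ) * a ^ (n + 1 - u) * b ^ (m - u))
    (n + 1)
  rw [Finset.sum_range_succ, hlast, add_zero] at this
  rw [this]
  simp

theorem gaussAmbiguity_eq (n m : ℕ) (τ ν : ℝ) :
    gaussAmbiguity n m τ ν = gaussAmbiguity 0 0 τ ν
      * laguerreSum n m (Complex.I * (2 * Real.pi * ν - Complex.I * τ))
        (Complex.I * (2 * Real.pi * ν + Complex.I * τ)) := by
  induction n generalizing m with
  | zero =>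
    induction m with
    | zero => simp [laguerreSum]
    | succ m ih =>
      rw [gaussAmbiguity_zero_succ, ih]
      simp only [laguerreSum, zero_add, Finset.range_one, Finset.sum_singleton]
      simp
      ring
  | succ n ih =>
    rw [gaussAmbiguity_succ_left, laguerreSum_succ_left, ih m, ih (m - 1)]
    ring

/-! ### The radial factor as a Gaussian times a polynomial. -/

theorem monomialHermiteCoeff_of_le {M j : ℕ} (h : 2 * j ≤ M) :
    monomialHermiteCoeff M j
      = (M.factorial : ℝ) / ((j.factorial : ℝ) * ((M - 2 * j).factorial : ℝ)) :=
  if_pos h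

theorem sum_hermitePoly_eq_sum_pow (n m : ℕ) (x : ℝ) :
    ∑ k ∈ Finset.range ((m + n) / 2 + 1), ∑ u ∈ Finset.range (min k (min n m) + 1),
        (-4 : ℝ) ^ u * ((n + m - 2 * u).factorial : ℝ)
          / ((u.factorial : ℝ) * ((m - u).factorial : ℝ) * ((n - u).factorial : ℝ)
              * ((k - u).factorial : ℝ))
          * ((hermitePoly (n + m - 2 * k)).eval x / ((n + m - 2 * k).factorial : ℝ))
      = 2 ^ (n + m) * ∑ u ∈ Finset.range (min n m + 1), (-1) ^ u * x ^ (n + m - 2 * u)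
          / ((u.factorial : ℝ) * ((m - u).factorial : ℝ) * ((n - u).factorial : ℝ)) := by
  -- With u outermost and k = u + j, the sum over j is the Hermite expansion of (2x)^{n+m-2u}.
  rw [Finset.sum_comm' (t' := Finset.range (min n m + 1))
    (s' := fun u => Finset.Ico u ((m + n) / 2 + 1))
    (by intro k u; simp only [Finset.mem_range, Finset.mem_Ico]; omega), Finset.mul_sum]
  refine Finset.sum_congr rfl fun u hu => ?_
  rw [Finset.mem_range] at hu
  rw [Finset.sum_Ico_eq_sum_range]
  have hpow := two_mul_pow_eq_sum_hermitePoly (n + m - 2 * u) ((m + n) / 2 + 1 - u) (by omega) x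
  have h4 : (-4 : ℝ) ^ u * 2 ^ (n + m - 2 * u) = 2 ^ (n + m) * (-1) ^ u := by
    rw [show (-4 : ℝ) = 2 ^ 2 * (-1) by norm_num, mul_pow, ← pow_mul]
    have : (2 : ℝ) ^ (n + m) = 2 ^ (2 * u) * 2 ^ (n + m - 2 * u) := by
      rw [← pow_add]; congr 1; omega
    rw [this]; ring
  calc _ = (-4 : ℝ) ^ u
          / ((u.factorial : ℝ) * ((m - u).factorial : ℝ) * ((n - u).factorial : ℝ))
          * (2 * x) ^ (n + m - 2 * u) := by
        rw [hpow, Finset.mul_sum]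
        refine Finset.sum_congr rfl fun j hj => ?_
        rw [Finset.mem_range] at hj
        rw [monomialHermiteCoeff_of_le (by omega), show u + j - u = j by omega,
          show n + m - 2 * (u + j) = n + m - 2 * u - 2 * j by omega]
        field_simp
    _ = _ := by
        rw [mul_pow, div_mul_eq_mul_div, ← mul_assoc, h4]
        ring

theorem hermiteV_mul_hermitePsi (k n m : ℕ) (hk : 2 * k ≤ n + m) (x : ℝ) :
    hermiteV k n m * hermitePsi (n + m - 2 * k) x
      = Real.pi ^ (-(1 / 4) : ℝ) * Real.exp (-x ^ 2 / 2) / Real.sqrt (2 ^ (n + m))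
        * ∑ u ∈ Finset.range (min k (min n m) + 1),
          (-4 : ℝ) ^ u * ((n + m - 2 * u).factorial : ℝ)
            / ((u.factorial : ℝ) * ((m - u).factorial : ℝ) * ((n - u).factorial : ℝ)
                * ((k - u).factorial : ℝ))
            * ((hermitePoly (n + m - 2 * k)).eval x / ((n + m - 2 * k).factorial : ℝ)) := by
  rw [← Finset.sum_mul, hermiteV, hermitePsi_eq, hermiteGauss]
  have h2 : Real.sqrt (2 ^ (n + m)) = 2 ^ k * Real.sqrt (2 ^ (n + m - 2 * k)) := by
    rw [show n + m = 2 * k + (n + m - 2 * k) by omega, pow_add, Real.sqrt_mul (by positivity),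
      pow_mul', Real.sqrt_sq (by positivity), Nat.add_sub_cancel_left]
  have hf : Real.sqrt ((n + m - 2 * k).factorial : ℝ) * Real.sqrt ((n + m - 2 * k).factorial : ℝ)
      = ((n + m - 2 * k).factorial : ℝ) := Real.mul_self_sqrt (by positivity)
  have hs : Real.sqrt ((n + m - 2 * k).factorial : ℝ) ≠ 0 := by positivity
  have hs2 : Real.sqrt ((2 : ℝ) ^ (n + m - 2 * k)) ≠ 0 := by positivity
  rw [Real.sqrt_mul (by positivity), h2]
  conv_rhs => rw [← hf]
  field_simp

theorem hermiteRadial_eq (n m : ℕ) (τ ν : ℝ) :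
    hermiteRadial n m τ ν = Real.sqrt ((n.factorial : ℝ) * (m.factorial : ℝ))
      * Real.exp (-(τ ^ 2 + (2 * Real.pi * ν) ^ 2) / 4)
      * ∑ u ∈ Finset.range (min n m + 1),
        (-1) ^ u * Real.sqrt ((τ ^ 2 + (2 * Real.pi * ν) ^ 2) / 2) ^ (n + m - 2 * u)
          / ((u.factorial : ℝ) * ((m - u).factorial : ℝ) * ((n - u).factorial : ℝ)) := by
  have hx := Real.sq_sqrt (show 0 ≤ (τ ^ 2 + (2 * Real.pi * ν) ^ 2) / 2 by positivity)
  have he : -(τ ^ 2 + (2 * Real.pi * ν) ^ 2) / 4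
      = -Real.sqrt ((τ ^ 2 + (2 * Real.pi * ν) ^ 2) / 2) ^ 2 / 2 := by
    rw [hx]; ring
  rw [hermiteRadial, he]
  set x := Real.sqrt ((τ ^ 2 + (2 * Real.pi * ν) ^ 2) / 2)
  rw [Finset.sum_congr rfl fun k hk => hermiteV_mul_hermitePsi k n m
    (by rw [Finset.mem_range] at hk; omega) x, ← Finset.mul_sum, sum_hermitePoly_eq_sum_pow,
    Real.sqrt_div (by positivity)]
  have hpi : Real.pi ^ ((1 / 4 : ℝ)) * Real.pi ^ (-(1 / 4) : ℝ) = 1 := by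
    rw [← Real.rpow_add Real.pi_pos]; simp
  have h2 : Real.sqrt (2 ^ (n + m)) * Real.sqrt (2 ^ (n + m)) = (2 : ℝ) ^ (n + m) :=
    Real.mul_self_sqrt (by positivity)
  have hs2 : Real.sqrt ((2 : ℝ) ^ (n + m)) ≠ 0 := by positivity
  set S := ∑ u ∈ Finset.range (min n m + 1), (-1) ^ u * x ^ (n + m - 2 * u)
          / ((u.factorial : ℝ) * ((m - u).factorial : ℝ) * ((n - u).factorial : ℝ))
  generalize Real.sqrt ((2 : ℝ) ^ (n + m)) = q at h2 hs2 ⊢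
  rw [← h2]
  field_simp
  linear_combination S * hpi

/-! ### Polar form and the closed form of the ambiguity function. -/

theorem polar_ambiguityAngle (τ ν : ℝ) :
    (2 * Real.pi * ν + Complex.I * τ : ℂ) = (Real.sqrt (τ ^ 2 + (2 * Real.pi * ν) ^ 2) : ℝ)
      * Complex.exp (Complex.I * (ambiguityAngle τ ν : ℂ)) := by
  have h := Complex.norm_mul_exp_arg_mul_I (((2 * Real.pi * ν : ℝ) : ℂ) + Complex.I * (τ : ℂ))
  have hn : ‖((2 * Real.pi * ν : ℝ) : ℂ) + Complex.I * (τ : ℂ)‖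
      = Real.sqrt (τ ^ 2 + (2 * Real.pi * ν) ^ 2) := by
    rw [mul_comm Complex.I, Complex.norm_add_mul_I, add_comm]
  rw [hn] at h
  rw [ambiguityAngle, mul_comm Complex.I ((Complex.arg _ : ℝ) : ℂ), h]
  push_cast
  ring

theorem polar_neg_ambiguityAngle (τ ν : ℝ) :
    (2 * Real.pi * ν - Complex.I * τ : ℂ) = (Real.sqrt (τ ^ 2 + (2 * Real.pi * ν) ^ 2) : ℝ)
      * Complex.exp (-(Complex.I * (ambiguityAngle τ ν : ℂ))) := by
  have h := congrArg (starRingEnd ℂ) (polar_ambiguityAngle τ ν)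
  rw [map_mul, Complex.conj_ofReal, ← Complex.exp_conj] at h
  have h2 : (starRingEnd ℂ) 2 = 2 := Complex.conj_ofReal 2
  simpa [h2, Complex.conj_ofReal, ← sub_eq_add_neg] using h

theorem choose_mul_choose_mul_factorial {n m u : ℕ} (hn : u ≤ n) (hm : u ≤ m) :
    ((n.choose u : ℝ)) * m.choose u * u.factorial
      = n.factorial * m.factorial / (u.factorial * (m - u).factorial * (n - u).factorial) := by
  rw [Nat.cast_choose ℝ hn, Nat.cast_choose ℝ hm]
  field_simp

/-- Here a = i r e^{-iθ} and b = i r e^{iθ}, so a^{n-u} b^{m-u} has phase e^{-i(n-m)θ} for every u,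
and i^{n+m-2u} supplies (-1)^u. With r = √2 x, the powers of 2 combine to √(2^{n+m}). -/
theorem laguerreSum_polar (n m : ℕ) (τ ν : ℝ) :
    laguerreSum n m (Complex.I * (2 * Real.pi * ν - Complex.I * τ))
        (Complex.I * (2 * Real.pi * ν + Complex.I * τ))
      = Complex.I ^ (n + m)
        * Complex.exp (-(Complex.I * ((n : ℂ) - (m : ℂ)) * (ambiguityAngle τ ν : ℂ)))
        * (n.factorial * m.factorial * Real.sqrt (2 ^ (n + m)) * ∑ u ∈ Finset.range (min n m + 1),
          (-1) ^ u * Real.sqrt ((τ ^ 2 + (2 * Real.pi * ν) ^ 2) / 2) ^ (n + m - 2 * u)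
          / ((u.factorial : ℝ) * ((m - u).factorial : ℝ) * ((n - u).factorial : ℝ)) : ℝ) := by
  have hrange : laguerreSum n m (Complex.I * (2 * Real.pi * ν - Complex.I * τ))
        (Complex.I * (2 * Real.pi * ν + Complex.I * τ))
      = ∑ u ∈ Finset.range (min n m + 1),
        ((n.choose u * m.choose u * u.factorial * 2 ^ u : ℕ) : ℂ)
          * (Complex.I * (2 * Real.pi * ν - Complex.I * τ)) ^ (n - u)
          * (Complex.I * (2 * Real.pi * ν + Complex.I * τ)) ^ (m - u) := by
    symm
    refine Finset.sum_subset (Finset.range_mono (by omega)) fun u hu hu' => ?_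
    rw [Finset.mem_range] at hu hu'
    rw [Nat.choose_eq_zero_of_lt (show m < u by omega)]
    simp
  rw [hrange, Finset.mul_sum, Complex.ofReal_sum, Finset.mul_sum]
  refine Finset.sum_congr rfl fun u hu => ?_
  rw [Finset.mem_range] at hu
  have hun : u ≤ n := by omega
  have hum : u ≤ m := by omega
  obtain ⟨p, rfl⟩ := Nat.exists_eq_add_of_le hun
  obtain ⟨q, rfl⟩ := Nat.exists_eq_add_of_le hum
  have hr : Real.sqrt (τ ^ 2 + (2 * Real.pi * ν) ^ 2)
      = Real.sqrt 2 * Real.sqrt ((τ ^ 2 + (2 * Real.pi * ν) ^ 2) / 2) := by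
    rw [← Real.sqrt_mul (by norm_num)]
    congr 1
    ring
  have h2 : Real.sqrt (2 ^ (u + p + (u + q))) = 2 ^ u * Real.sqrt 2 ^ (p + q) := by
    rw [show u + p + (u + q) = u * 2 + (p + q) by ring, pow_add, Real.sqrt_mul (by positivity),
      pow_mul, Real.sqrt_sq (by positivity)]
    congr 1
    rw [Real.sqrt_eq_iff_mul_self_eq (by positivity) (by positivity), ← mul_pow]
    simp
  have hexp : Complex.exp (-(Complex.I * (((u + p : ℕ) : ℂ) - ((u + q : ℕ) : ℂ))
        * (ambiguityAngle τ ν : ℂ)))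
      = Complex.exp (-(Complex.I * (ambiguityAngle τ ν : ℂ))) ^ p
        * Complex.exp (Complex.I * (ambiguityAngle τ ν : ℂ)) ^ q := by
    rw [← Complex.exp_nat_mul, ← Complex.exp_nat_mul, ← Complex.exp_add]
    congr 1
    push_cast
    ring
  have hI : Complex.I ^ (u + p + (u + q)) * (-1) ^ u = Complex.I ^ (p + q) := by
    rw [show u + p + (u + q) = 2 * u + (p + q) by ring, pow_add, pow_mul, Complex.I_sq]
    rw [mul_right_comm, ← mul_pow]
    simp
  have hc := congrArg (fun r : ℝ => (r : ℂ))
    (choose_mul_choose_mul_factorial (Nat.le_add_right u p) (Nat.le_add_right u q))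
  rw [polar_ambiguityAngle, polar_neg_ambiguityAngle, hr, h2, hexp]
  rw [show u + p + (u + q) - 2 * u = p + q by omega]
  simp only [Nat.add_sub_cancel_left] at hc ⊢
  set x := Real.sqrt ((τ ^ 2 + (2 * Real.pi * ν) ^ 2) / 2)
  set E := Complex.exp (Complex.I * (ambiguityAngle τ ν : ℂ))
  set E' := Complex.exp (-(Complex.I * (ambiguityAngle τ ν : ℂ)))
  push_cast at hc ⊢
  rw [hc]
  calc _ = Complex.I ^ (p + q) * (((u + p).factorial * (u + q).factorial /
        (u.factorial * q.factorial * p.factorial)) * 2 ^ u * (Real.sqrt 2 : ℂ) ^ (p + q)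
        * (x : ℂ) ^ (p + q) * E' ^ p * E ^ q) := by ring
    _ = _ := by rw [← hI]; ring

theorem ambiguityIntegrand_hermitePsi (n m : ℕ) (τ ν : ℝ) :
    ambiguityIntegrand (fun t => (hermitePsi n t : ℂ)) (fun t => (hermitePsi m t : ℂ)) τ ν
      = fun t => ((Real.pi ^ (-(1 / 4) : ℝ) / Real.sqrt (2 ^ n * (n.factorial : ℝ))
        * (Real.pi ^ (-(1 / 4) : ℝ) / Real.sqrt (2 ^ m * (m.factorial : ℝ))) : ℝ) : ℂ)
        * gaussIntegrand n m τ ν t := by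
  ext t
  simp only [gaussIntegrand, ambiguityIntegrand, hermitePsi_eq, map_mul, Complex.conj_ofReal,
    Complex.ofReal_mul]
  ring

theorem integrable_hermiteAmbiguity (n m : ℕ) (τ ν : ℝ) :
    MeasureTheory.Integrable (ambiguityIntegrand
      (fun t => (hermitePsi n t : ℂ)) (fun t => (hermitePsi m t : ℂ)) τ ν) := by
  rw [ambiguityIntegrand_hermitePsi]
  exact (integrable_gaussIntegrand n m τ ν).const_mul _

theorem hermiteAmbiguity_closed_form (n m : ℕ) (τ ν : ℝ) :
    hermiteAmbiguity n m τ ν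
      = Complex.I ^ (n + m)
        * Complex.exp (-(Complex.I * ((n : ℂ) - (m : ℂ)) * (ambiguityAngle τ ν : ℂ)))
        * (hermiteRadial n m τ ν : ℂ) := by
  rw [hermiteAmbiguity, crossAmbiguity, ambiguityIntegrand_hermitePsi,
    MeasureTheory.integral_const_mul, ← gaussAmbiguity, gaussAmbiguity_eq, laguerreSum_polar,
    gaussAmbiguity_zero_zero, hermiteRadial_eq]
  set S := ∑ u ∈ Finset.range (min n m + 1),
          (-1) ^ u * Real.sqrt ((τ ^ 2 + (2 * Real.pi * ν) ^ 2) / 2) ^ (n + m - 2 * u)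
          / ((u.factorial : ℝ) * ((m - u).factorial : ℝ) * ((n - u).factorial : ℝ))
  have hpi : Real.pi ^ (-(1 / 4) : ℝ) * Real.pi ^ (-(1 / 4) : ℝ) * Real.sqrt Real.pi = 1 := by
    rw [Real.sqrt_eq_rpow, ← Real.rpow_add Real.pi_pos, ← Real.rpow_add Real.pi_pos]
    norm_num
  have hf : Real.sqrt ((n.factorial : ℝ) * m.factorial)
      * Real.sqrt ((n.factorial : ℝ) * m.factorial)
      = n.factorial * m.factorial := Real.mul_self_sqrt (by positivity)
  have hs : Real.sqrt (2 ^ n * (n.factorial : ℝ)) * Real.sqrt (2 ^ m * (m.factorial : ℝ))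
      = Real.sqrt (2 ^ (n + m)) * Real.sqrt ((n.factorial : ℝ) * m.factorial) := by
    rw [← Real.sqrt_mul (by positivity), ← Real.sqrt_mul (by positivity)]
    congr 1
    ring
  have hreal : Real.pi ^ (-(1 / 4) : ℝ) / Real.sqrt (2 ^ n * (n.factorial : ℝ))
        * (Real.pi ^ (-(1 / 4) : ℝ) / Real.sqrt (2 ^ m * (m.factorial : ℝ)))
        * (Real.sqrt Real.pi * Real.exp (-(τ ^ 2 + (2 * Real.pi * ν) ^ 2) / 4))
        * (n.factorial * m.factorial * Real.sqrt (2 ^ (n + m)) * S)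
      = Real.sqrt ((n.factorial : ℝ) * m.factorial)
        * Real.exp (-(τ ^ 2 + (2 * Real.pi * ν) ^ 2) / 4) * S := by
    have h1 : Real.sqrt ((2 : ℝ) ^ (n + m)) ≠ 0 := by positivity
    have h2 : Real.sqrt ((n.factorial : ℝ) * m.factorial) ≠ 0 := by positivity
    rw [div_mul_div_comm, hs]
    generalize Real.sqrt ((n.factorial : ℝ) * m.factorial) = q at hf h2 ⊢
    rw [← hf]
    calc _ = (Real.pi ^ (-(1 / 4) : ℝ) * Real.pi ^ (-(1 / 4) : ℝ) * Real.sqrt Real.pi)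
          * (q * Real.exp (-(τ ^ 2 + (2 * Real.pi * ν) ^ 2) / 4) * S) := by field_simp
      _ = _ := by rw [hpi, one_mul]
  rw [← hreal]
  simp only [Complex.ofReal_mul]
  ring

/-! ### The effective channel of even separable pulses. -/

theorem measureTwistedConv_physicalChannel {P : ℕ} (h : Fin P → ℂ) (τp νp : Fin P → ℝ)
    (b : ℝ → ℝ → ℂ) (τ ν : ℝ) :
    measureTwistedConv (physicalChannel h τp νp) b τ ν
      = ∑ i : Fin P, h i * (b (τ - τp i) (ν - νp i)
        * Complex.exp (2 * Real.pi * Complex.I * νp i * (τ - τp i))) := by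
  rw [measureTwistedConv, physicalChannel,
    MeasureTheory.VectorMeasure.integral_finsetSum_vectorMeasure]
  · refine Finset.sum_congr rfl fun i _ => ?_
    rw [MeasureTheory.VectorMeasure.integral_dirac]
    simp only [ContinuousLinearMap.mul_apply']
    ring
  · intro i _
    -- The variation is a finite multiple of a point mass, so `b` needs no regularity.
    rw [MeasureTheory.VectorMeasure.Integrable, MeasureTheory.VectorMeasure.variation_dirac]
    exact (MeasureTheory.integrable_dirac enorm_lt_top).smul_measure (by simp)

theorem hermitePsi_even (n : ℕ) (t : ℝ) : hermitePsi (2 * n) (-t) = hermitePsi (2 * n) t := by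
  simp [hermitePsi, hermiteH_eq_eval, hermitePoly_eval_neg]

theorem hermitePulse_even {N : ℕ} (a : Fin N → ℝ) (σ t : ℝ) :
    hermitePulse a σ (-t) = hermitePulse a σ t := by
  simp [hermitePulse, hermitePhi, hermitePsi_even]

/-- The two factors √σ are kept together as σ, the Jacobian of the substitution σt. -/
theorem ambiguityIntegrand_hermitePulse {N : ℕ} (a : Fin N → ℝ) {σ : ℝ} (hσ : 0 < σ)
    (τ ν t : ℝ) :
    ambiguityIntegrand (fun t => (hermitePulse a σ t : ℂ)) (fun t => (hermitePulse a σ t : ℂ))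
        τ ν t
      = ∑ n : Fin N, ∑ m : Fin N, (a n : ℂ) * (a m : ℂ) * ((σ : ℂ)
        * ambiguityIntegrand (fun t => (hermitePsi (2 * n) t : ℂ))
          (fun t => (hermitePsi (2 * m) t : ℂ)) (σ * τ) (ν / σ) (σ * t)) := by
  have hs : ((Real.sqrt σ : ℝ) : ℂ) * (Real.sqrt σ : ℝ) = σ := by
    rw [← Complex.ofReal_mul, Real.mul_self_sqrt hσ.le]
  have hc : (σ : ℂ) ≠ 0 := Complex.ofReal_ne_zero.2 hσ.ne'
  simp only [ambiguityIntegrand, hermitePulse, hermitePhi, Complex.conj_ofReal]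
  rw [← Complex.ofReal_mul, Finset.sum_mul_sum]
  push_cast
  rw [Finset.sum_mul]
  refine Finset.sum_congr rfl fun n _ => ?_
  rw [Finset.sum_mul]
  refine Finset.sum_congr rfl fun m _ => ?_
  rw [← hs, show σ * (t + τ / 2) = σ * t + σ * τ / 2 by ring,
    show σ * (t - τ / 2) = σ * t - σ * τ / 2 by ring, hs,
    show 2 * Real.pi * Complex.I * (ν / σ) * (σ * t) = 2 * Real.pi * Complex.I * ν * t by
      field_simp, ← hs]
  ring

theorem integrable_ambiguityIntegrand_hermitePulse {N : ℕ} (a : Fin N → ℝ) {σ : ℝ} (hσ : 0 < σ)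
    (τ ν : ℝ) :
    MeasureTheory.Integrable (ambiguityIntegrand (fun t => (hermitePulse a σ t : ℂ))
      (fun t => (hermitePulse a σ t : ℂ)) τ ν) := by
  rw [funext fun t => ambiguityIntegrand_hermitePulse a hσ τ ν t]
  exact MeasureTheory.integrable_finsetSum _ fun n _ =>
    MeasureTheory.integrable_finsetSum _ fun m _ =>
      (((integrable_hermiteAmbiguity (2 * n) (2 * m) (σ * τ) (ν / σ)).comp_mul_left'
        hσ.ne').const_mul _).const_mul _

theorem crossAmbiguity_hermitePulse {N : ℕ} (a : Fin N → ℝ) {σ : ℝ} (hσ : 0 < σ) (τ ν : ℝ) :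
    crossAmbiguity (fun t => (hermitePulse a σ t : ℂ)) (fun t => (hermitePulse a σ t : ℂ)) τ ν
      = ∑ n : Fin N, ∑ m : Fin N, (a n : ℂ) * (a m : ℂ)
        * hermiteAmbiguity (2 * n) (2 * m) (σ * τ) (ν / σ) := by
  have hi := fun n m : Fin N => (integrable_hermiteAmbiguity (2 * n) (2 * m) (σ * τ) (ν / σ)
    ).comp_mul_left' hσ.ne'
  simp only [crossAmbiguity, ambiguityIntegrand_hermitePulse a hσ]
  rw [MeasureTheory.integral_finsetSum _ fun n _ => MeasureTheory.integrable_finsetSum _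
      fun m _ => ((hi n m).const_mul _).const_mul _]
  refine Finset.sum_congr rfl fun n _ => ?_
  rw [MeasureTheory.integral_finsetSum _ fun m _ => ((hi n m).const_mul _).const_mul _]
  refine Finset.sum_congr rfl fun m _ => ?_
  rw [MeasureTheory.integral_const_mul, MeasureTheory.integral_const_mul,
    MeasureTheory.Measure.integral_comp_mul_left, hermiteAmbiguity, crossAmbiguity,
    abs_of_pos (inv_pos.2 hσ), Complex.real_smul, ← mul_assoc (σ : ℂ), Complex.ofReal_inv,
    mul_inv_cancel₀ (Complex.ofReal_ne_zero.2 hσ.ne'), one_mul]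

/-- The substitution t ↦ -t exchanges the two factors of the integrand. -/
theorem crossAmbiguity_neg_right_of_even {w : ℝ → ℂ} (hw : ∀ t, w (-t) = w t)
    (hr : ∀ t, starRingEnd ℂ (w t) = w t) (τ ν : ℝ) :
    crossAmbiguity w w τ (-ν) = crossAmbiguity w w τ ν := by
  rw [crossAmbiguity, ← MeasureTheory.integral_neg_eq_self, crossAmbiguity]
  refine MeasureTheory.integral_congr_ae (Filter.Eventually.of_forall fun t => ?_)
  simp only [ambiguityIntegrand, hr]
  rw [show -t + τ / 2 = -(t - τ / 2) by ring, show -t - τ / 2 = -(t + τ / 2) by ring, hw, hw,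
    mul_comm (w _)]
  congr 2
  push_cast
  ring

/-- A reflected and shifted ambiguity integrand, as it occurs in the twisted convolution. -/
theorem ambiguityIntegrand_reflect {w : ℝ → ℂ} (hr : ∀ t, starRingEnd ℂ (w t) = w t)
    (x y s : ℝ) :
    w (-s) * w (-s - x) * Complex.exp (-(2 * Real.pi * Complex.I * y * s))
      = Complex.exp (Complex.I * Real.pi * y * x)
        * ambiguityIntegrand w w x y (-x / 2 - s) := by
  simp only [ambiguityIntegrand, hr]
  rw [show -x / 2 - s + x / 2 = -s by ring, show -x / 2 - s - x / 2 = -s - x by ring,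
    mul_left_comm, ← Complex.exp_add]
  congr 2
  push_cast
  ring

theorem integrable_reflect {w : ℝ → ℂ} (hr : ∀ t, starRingEnd ℂ (w t) = w t) {x y : ℝ}
    (hi : MeasureTheory.Integrable (ambiguityIntegrand w w x y)) :
    MeasureTheory.Integrable (fun s : ℝ =>
      w (-s) * w (-s - x) * Complex.exp (-(2 * Real.pi * Complex.I * y * s))) := by
  simp only [ambiguityIntegrand_reflect hr]
  exact (hi.comp_sub_left (-x / 2)).const_mul _

theorem integral_reflect {w : ℝ → ℂ} (hr : ∀ t, starRingEnd ℂ (w t) = w t) (x y : ℝ) :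
    ∫ s : ℝ, w (-s) * w (-s - x) * Complex.exp (-(2 * Real.pi * Complex.I * y * s))
      = Complex.exp (Complex.I * Real.pi * y * x) * crossAmbiguity w w x y := by
  simp only [ambiguityIntegrand_reflect hr]
  rw [MeasureTheory.integral_const_mul, MeasureTheory.integral_sub_left_eq_self
    (ambiguityIntegrand w w x y), crossAmbiguity]

theorem twistedIntegrand_matchedFilter {P : ℕ} (h : Fin P → ℂ) (τp νp : Fin P → ℝ)
    (w₁ w₂ : ℝ → ℝ) (τ ν : ℝ) (p : ℝ × ℝ) :
    twistedIntegrand (matchedFilter (separableFilter w₁ w₂))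
        (measureTwistedConv (physicalChannel h τp νp) (separableFilter w₁ w₂)) τ ν p
      = ∑ i : Fin P, h i * Complex.exp (2 * Real.pi * Complex.I * νp i * (τ - τp i))
        * (((w₁ (-p.1) : ℂ) * (w₁ (-p.1 - (τp i - τ)) : ℂ)
              * Complex.exp (-(2 * Real.pi * Complex.I * νp i * p.1)))
          * ((w₂ (-p.2) : ℂ) * (w₂ (-p.2 - (νp i - ν)) : ℂ)
              * Complex.exp (-(2 * Real.pi * Complex.I * ((-τ : ℝ) : ℂ) * p.2)))) := by
  rw [twistedIntegrand, measureTwistedConv_physicalChannel, Finset.mul_sum, Finset.sum_mul]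
  refine Finset.sum_congr rfl fun i _ => ?_
  -- The terms ±ν'τ' cancel; what is left separates into a phase in τ' and one in ν'.
  have he : Complex.exp (2 * Real.pi * Complex.I * p.2 * p.1)
      * Complex.exp (2 * Real.pi * Complex.I * νp i * ((τ - p.1 : ℝ) - τp i))
      * Complex.exp (2 * Real.pi * Complex.I * p.2 * (τ - p.1))
      = Complex.exp (2 * Real.pi * Complex.I * νp i * (τ - τp i))
        * Complex.exp (-(2 * Real.pi * Complex.I * νp i * p.1))
        * Complex.exp (-(2 * Real.pi * Complex.I * ((-τ : ℝ) : ℂ) * p.2)) := by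
    rw [← Complex.exp_add, ← Complex.exp_add, ← Complex.exp_add, ← Complex.exp_add]
    congr 1
    push_cast
    ring
  simp only [matchedFilter, separableFilter, map_mul, Complex.conj_ofReal]
  rw [show τ - p.1 - τp i = -p.1 - (τp i - τ) by ring,
    show ν - p.2 - νp i = -p.2 - (νp i - ν) by ring]
  linear_combination (h i * (w₁ (-p.1) : ℂ) * (w₁ (-p.1 - (τp i - τ)) : ℂ)
    * (w₂ (-p.2) : ℂ) * (w₂ (-p.2 - (νp i - ν)) : ℂ)) * he

theorem integrable_twistedIntegrand_term {w₁ w₂ : ℝ → ℝ}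
    (h₁ : ∀ τ ν, MeasureTheory.Integrable
      (ambiguityIntegrand (fun t => (w₁ t : ℂ)) (fun t => (w₁ t : ℂ)) τ ν))
    (h₂ : ∀ τ ν, MeasureTheory.Integrable
      (ambiguityIntegrand (fun t => (w₂ t : ℂ)) (fun t => (w₂ t : ℂ)) τ ν))
    (x y x' y' : ℝ) :
    MeasureTheory.Integrable (fun p : ℝ × ℝ =>
      ((w₁ (-p.1) : ℂ) * (w₁ (-p.1 - x) : ℂ) * Complex.exp (-(2 * Real.pi * Complex.I * y * p.1)))
        * ((w₂ (-p.2) : ℂ) * (w₂ (-p.2 - x') : ℂ)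
          * Complex.exp (-(2 * Real.pi * Complex.I * y' * p.2)))) :=
  (integrable_reflect (fun t => Complex.conj_ofReal (w₁ t)) (h₁ x y)).mul_prod
    (integrable_reflect (fun t => Complex.conj_ofReal (w₂ t)) (h₂ x' y'))

theorem effectiveChannel_separableFilter {P : ℕ} (h : Fin P → ℂ) (τp νp : Fin P → ℝ)
    {w₁ w₂ : ℝ → ℝ}
    (h₁ : ∀ τ ν, MeasureTheory.Integrable
      (ambiguityIntegrand (fun t => (w₁ t : ℂ)) (fun t => (w₁ t : ℂ)) τ ν))
    (h₂ : ∀ τ ν, MeasureTheory.Integrable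
      (ambiguityIntegrand (fun t => (w₂ t : ℂ)) (fun t => (w₂ t : ℂ)) τ ν))
    (τ ν : ℝ) :
    effectiveChannel (physicalChannel h τp νp) (separableFilter w₁ w₂) τ ν
      = Complex.exp (Complex.I * Real.pi * ν * τ)
        * ∑ i : Fin P, h i * Complex.exp (-(Complex.I * Real.pi * νp i * τp i))
          * crossAmbiguity (fun t => (w₁ t : ℂ)) (fun t => (w₁ t : ℂ)) (τp i - τ) (νp i)
          * crossAmbiguity (fun t => (w₂ t : ℂ)) (fun t => (w₂ t : ℂ)) (νp i - ν) (-τ) := by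
  rw [effectiveChannel, twistedConv,
    funext fun p => twistedIntegrand_matchedFilter h τp νp w₁ w₂ τ ν p,
    MeasureTheory.integral_finsetSum _ fun i _ =>
      (integrable_twistedIntegrand_term h₁ h₂ _ _ _ _).const_mul _, Finset.mul_sum]
  refine Finset.sum_congr rfl fun i _ => ?_
  have hprod := MeasureTheory.integral_prod_mul (μ := MeasureTheory.volume)
    (ν := MeasureTheory.volume)
    (fun s : ℝ => (w₁ (-s) : ℂ) * (w₁ (-s - (τp i - τ)) : ℂ)
      * Complex.exp (-(2 * Real.pi * Complex.I * νp i * s)))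
    (fun s : ℝ => (w₂ (-s) : ℂ) * (w₂ (-s - (νp i - ν)) : ℂ)
      * Complex.exp (-(2 * Real.pi * Complex.I * ((-τ : ℝ) : ℂ) * s)))
  have e₁ := integral_reflect (fun t => Complex.conj_ofReal (w₁ t)) (τp i - τ) (νp i)
  have e₂ := integral_reflect (fun t => Complex.conj_ofReal (w₂ t)) (νp i - ν) (-τ)
  rw [e₁, e₂] at hprod
  rw [MeasureTheory.integral_const_mul, MeasureTheory.Measure.volume_eq_prod, hprod]
  -- In units of iπ: 2ν_i(τ - τ_i) + ν_i(τ_i - τ) - τ(ν_i - ν) = ντ - ν_iτ_i.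
  have he : Complex.exp (2 * Real.pi * Complex.I * νp i * (τ - τp i))
      * Complex.exp (Complex.I * Real.pi * νp i * ((τp i - τ : ℝ) : ℂ))
      * Complex.exp (Complex.I * Real.pi * ((-τ : ℝ) : ℂ) * ((νp i - ν : ℝ) : ℂ))
      = Complex.exp (Complex.I * Real.pi * ν * τ)
        * Complex.exp (-(Complex.I * Real.pi * νp i * τp i)) := by
    rw [← Complex.exp_add, ← Complex.exp_add, ← Complex.exp_add]
    congr 1
    push_cast
    ring
  linear_combination (h i
    * crossAmbiguity (fun t => (w₁ t : ℂ)) (fun t => (w₁ t : ℂ)) (τp i - τ) (νp i)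
    * crossAmbiguity (fun t => (w₂ t : ℂ)) (fun t => (w₂ t : ℂ)) (νp i - ν) (-τ)) * he

theorem crossAmbiguity_hermitePulse_neg {N : ℕ} (a : Fin N → ℝ) {σ : ℝ} (hσ : 0 < σ) (τ ν : ℝ) :
    crossAmbiguity (fun t => (hermitePulse a σ t : ℂ)) (fun t => (hermitePulse a σ t : ℂ)) τ ν
      = ∑ n : Fin N, ∑ m : Fin N, (a n : ℂ) * (a m : ℂ)
        * hermiteAmbiguity (2 * n) (2 * m) (σ * τ) (-ν / σ) := by
  rw [← crossAmbiguity_hermitePulse a hσ]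
  exact (crossAmbiguity_neg_right_of_even (fun t => by rw [hermitePulse_even])
    (fun t => Complex.conj_ofReal _) τ ν).symm

/-! ### Reversing the phases. -/

theorem hermiteV_comm (k n m : ℕ) : hermiteV k n m = hermiteV k m n := by
  rw [hermiteV, hermiteV, add_comm n m, min_comm n m]
  congr 1
  refine Finset.sum_congr rfl fun u _ => ?_
  ring

theorem hermiteRadial_comm (n m : ℕ) (τ ν : ℝ) : hermiteRadial n m τ ν = hermiteRadial m n τ ν := by
  simp only [hermiteRadial, hermiteV_comm _ n m, add_comm n m, mul_comm (n.factorial : ℝ)]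

/-- For even indices (-i)^{2n+2m} = i^{2n+2m}, and R is symmetric, so only the sign of n - m
differs. -/
theorem hermiteClosedForm_eq_hermiteAmbiguity_swap (n m : ℕ) (τ ν : ℝ) :
    hermiteClosedForm (2 * n) (2 * m) τ ν = hermiteAmbiguity (2 * m) (2 * n) τ ν := by
  rw [hermiteAmbiguity_closed_form, hermiteClosedForm, hermiteRadial_comm, ← mul_add, ← mul_add,
    pow_mul, pow_mul, neg_sq, add_comm m n]
  congr 3
  ring

theorem sum_hermiteClosedForm {N : ℕ} (a : Fin N → ℝ) (τ ν : ℝ) :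
    ∑ n : Fin N, ∑ m : Fin N, (a n : ℂ) * (a m : ℂ) * hermiteClosedForm (2 * n) (2 * m) τ ν
      = ∑ n : Fin N, ∑ m : Fin N, (a n : ℂ) * (a m : ℂ)
        * hermiteAmbiguity (2 * n) (2 * m) τ ν := by
  rw [Finset.sum_comm]
  refine Finset.sum_congr rfl fun n _ => Finset.sum_congr rfl fun m _ => ?_
  rw [hermiteClosedForm_eq_hermiteAmbiguity_swap, mul_comm (a m : ℂ)]

theorem theorem2 {P Nc : ℕ} (h : Fin P → ℂ) (τp νp : Fin P → ℝ) (c d : Fin Nc → ℝ)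
    (στ σν : ℝ) (hστ : 0 < στ) (hσν : 0 < σν) :
    -- the twisted convolution integral which defines the effective channel converges absolutely
    (∀ τ ν : ℝ, MeasureTheory.Integrable
      (twistedIntegrand
        (matchedFilter (separableFilter (hermitePulse c στ) (hermitePulse d σν)))
        (measureTwistedConv (physicalChannel h τp νp)
          (separableFilter (hermitePulse c στ) (hermitePulse d σν))) τ ν)) ∧
    -- the effective channel in terms of the cross-ambiguity functions of the Hermite functions
    (∀ τ ν : ℝ,
      effectiveChannel (physicalChannel h τp νp)
          (separableFilter (hermitePulse c στ) (hermitePulse d σν)) τ ν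
        = Complex.exp (Complex.I * Real.pi * ν * τ)
          * ∑ i : Fin P, h i * Complex.exp (-(Complex.I * Real.pi * νp i * τp i))
            * (∑ n₁ : Fin Nc, ∑ m₁ : Fin Nc, (c n₁ : ℂ) * (c m₁ : ℂ)
                * hermiteAmbiguity (2 * n₁) (2 * m₁) (στ * (τp i - τ)) (-νp i / στ))
            * (∑ n₂ : Fin Nc, ∑ m₂ : Fin Nc, (d n₂ : ℂ) * (d m₂ : ℂ)
                * hermiteAmbiguity (2 * n₂) (2 * m₂) (σν * (νp i - ν)) (τ / σν))) ∧
    -- the cross-ambiguity functions of the Hermite functions in closed form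
    (∀ (n m : ℕ) (τ ν : ℝ),
      MeasureTheory.Integrable (ambiguityIntegrand
        (fun t => (hermitePsi n t : ℂ)) (fun t => (hermitePsi m t : ℂ)) τ ν) ∧
      hermiteAmbiguity n m τ ν
        = Complex.I ^ (n + m)
          * Complex.exp (-(Complex.I * ((n : ℂ) - (m : ℂ)) * (ambiguityAngle τ ν : ℂ)))
          * (hermiteRadial n m τ ν : ℂ)) ∧
    -- the effective channel in closed form, where the phases may have the opposite sign
    (∀ τ ν : ℝ,
      effectiveChannel (physicalChannel h τp νp)
          (separableFilter (hermitePulse c στ) (hermitePulse d σν)) τ ν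
        = Complex.exp (Complex.I * Real.pi * ν * τ)
          * ∑ i : Fin P, h i * Complex.exp (-(Complex.I * Real.pi * νp i * τp i))
            * (∑ n₁ : Fin Nc, ∑ m₁ : Fin Nc, (c n₁ : ℂ) * (c m₁ : ℂ)
                * hermiteClosedForm (2 * n₁) (2 * m₁) (στ * (τp i - τ)) (-νp i / στ))
            * (∑ n₂ : Fin Nc, ∑ m₂ : Fin Nc, (d n₂ : ℂ) * (d m₂ : ℂ)
                * hermiteClosedForm (2 * n₂) (2 * m₂) (σν * (νp i - ν)) (τ / σν))) := by
  have heff : ∀ τ ν : ℝ,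
      effectiveChannel (physicalChannel h τp νp)
          (separableFilter (hermitePulse c στ) (hermitePulse d σν)) τ ν
        = Complex.exp (Complex.I * Real.pi * ν * τ)
          * ∑ i : Fin P, h i * Complex.exp (-(Complex.I * Real.pi * νp i * τp i))
            * (∑ n₁ : Fin Nc, ∑ m₁ : Fin Nc, (c n₁ : ℂ) * (c m₁ : ℂ)
                * hermiteAmbiguity (2 * n₁) (2 * m₁) (στ * (τp i - τ)) (-νp i / στ))
            * (∑ n₂ : Fin Nc, ∑ m₂ : Fin Nc, (d n₂ : ℂ) * (d m₂ : ℂ)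
                * hermiteAmbiguity (2 * n₂) (2 * m₂) (σν * (νp i - ν)) (τ / σν)) := by
    intro τ ν
    rw [effectiveChannel_separableFilter h τp νp
      (integrable_ambiguityIntegrand_hermitePulse c hστ)
      (integrable_ambiguityIntegrand_hermitePulse d hσν)]
    simp only [crossAmbiguity_hermitePulse_neg c hστ, crossAmbiguity_hermitePulse_neg d hσν,
      neg_neg]
  refine ⟨fun τ ν => ?_, heff,
    fun n m τ ν => ⟨integrable_hermiteAmbiguity n m τ ν, hermiteAmbiguity_closed_form n m τ ν⟩,
    fun τ ν => ?_⟩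
  · rw [funext fun p => twistedIntegrand_matchedFilter h τp νp (hermitePulse c στ)
      (hermitePulse d σν) τ ν p]
    exact MeasureTheory.integrable_finsetSum _ fun i _ => (integrable_twistedIntegrand_term
      (integrable_ambiguityIntegrand_hermitePulse c hστ)
      (integrable_ambiguityIntegrand_hermitePulse d hσν) _ _ _ _).const_mul _
  · simp only [heff, sum_hermiteClosedForm]
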